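/- Cells are elements $(i,j)\in\mathbb Z^2$, where $i$ is the row (increasing downwards) and $j$ the column (increasing to the right). A standard Young tableau of a finite shape $S\subset\mathbb Z^2$ is an injective map $\tau:S\to\{1,\dots,|S|\}$ with $\tau(i,j)<\tau(i,j+1)$ whenever $(i,j),(i,j+1)\in S$ and $\tau(i,j)<\tau(i+1,j)$ whenever $(i,j),(i+1,j)\in S$; $SYT(S)$ is the set of all of them. A periodic shape is a finite set $P\subset\mathbb Z^2$ containing $(1,1)$ which, up to translation, is a skew shape $\lambda/\mu$ drawn in French notation (longest row of $\lambda$ at the bottom), which is connected (any two cells are joined by a path of unit horizontal and vertical steps in $P$), and such that every column of $P$ other than its left-most and right-most columns contains a cell $(i,j)$ with $(i,j-1),(i,j+1)\in P$. Let $w\ge 0$ be an integer, let $a$ and $b$ be the left-most cells of the top row and of the bottom row of $P$, put $\nabla=b-a+(1,w)$ and, for $m\ge1$, $$Sh^w(P,m)=\bigcup_{i=0}^{m-1}(P+i\nabla),\qquad P_w(m)=|SYT(Sh^w(P,m))|.$$ $P$ and $w$ are compatible if $Sh^w(P,n)$ is a periodic shape for every $n\ge1$ and the number of cells in a column of $Sh^w(P,n)$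 is bounded uniformly in $n$ and the column. For compatible $P,w$, let $m$ be sufficiently large, let $S=Sh^w(P,m)$ and let $u=a+m\nabla-(1,0)$, a cell of the bottom row of $S$. The index shape $I(P,w)$ is the set consisting of $u$ and of all cells of $S$ that are not below the row of $u$ and lie in columns strictly to the right of that of $u$, translated so that its top row is row $1$ and its left-most column is column $1$; it does not depend on $m$. Let $\dim(P,w)=|SYT(I(P,w))|$ and let $N(P,w)$ be the smallest $m\ge1$ such that $I(P,w)+v\subseteq Sh^w(P,m)$ for some $v\in\mathbb Z^2$. Theorem. Let $P$ be a periodic shape and $w$ a non-negative integer such that $P$ and $w$ are compatible. Then the sequence $P_w(n)$, $n\ge N(P,w)+\dim(P,w)$, satisfies a constant-coefficient linear recurrence of order at most $\dim(P,w)$: there are an integer $r$ with $1\le r\le\dim(P,w)$ and integers $c_1,\dots,c_r$ with $c_r\ne0$ such that $$P_w(n)=\sum_{i=1}^{r}c_i\,P_w(n-i)\qquad\text{for all }n\ge N(P,w)+\dim(P,w).$$ -/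

import Mathlib

/-!
Cells are elements `(i, j)` of `ℤ × ℤ` in matrix coordinates: `i` is the row, increasing
downwards, and `j` is the column, increasing to the right.
-/

namespace PeriodicSYT

/-- The translate `S + v`. -/
def translate (S : Set (ℤ × ℤ)) (v : ℤ × ℤ) : Set (ℤ × ℤ) := (fun x => x + v) '' S

/-- A filling `f` of `S` is a partial tableau: it is injective with positive values, and it
increases along adjacent cells of a row and down adjacent cells of a column. -/
structure IsPartialTableau (S : Set (ℤ × ℤ)) (f : S → ℕ) : Prop where
  pos : ∀ x, 0 < f x
  injective : Function.Injective f
  row_lt : ∀ (i j : ℤ) (h : (i, j) ∈ S) (h' : (i, j + 1) ∈ S), f ⟨(i, j), h⟩ < f ⟨(i, j + 1), h'⟩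
  col_lt : ∀ (i j : ℤ) (h : (i, j) ∈ S) (h' : (i + 1, j) ∈ S), f ⟨(i, j), h⟩ < f ⟨(i + 1, j), h'⟩

/-- The set of standard Young tableaux of shape `S` (for `S` finite). -/
def SYT (S : Set (ℤ × ℤ)) : Set (S → ℕ) :=
  {f | IsPartialTableau S f ∧ ∀ x, f x ∈ Set.Icc 1 S.ncard}

/-- Any two cells of `S` are joined by a path in `S` of unit horizontal and vertical steps. -/
def IsConnectedShape (S : Set (ℤ × ℤ)) : Prop :=
  ∀ u ∈ S, ∀ v ∈ S,
    Relation.ReflTransGen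
      (fun x y : ℤ × ℤ => x ∈ S ∧ y ∈ S ∧
        y - x ∈ ({(1, 0), (0, 1), (-1, 0), (0, -1)} : Set (ℤ × ℤ))) u v

/-- `S` is, up to translation, a skew shape `lam / mu` drawn in French notation: the row with
index `0` of the Young diagrams is the bottom row, and the row index grows upwards. -/
def IsFrenchSkewShape (S : Set (ℤ × ℤ)) : Prop :=
  ∃ lam mu : YoungDiagram, mu ≤ lam ∧ ∃ v : ℤ × ℤ,
    S = (fun c : ℕ × ℕ => ((-(c.1 : ℤ), (c.2 : ℤ)) : ℤ × ℤ) + v) ''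
      {c | c ∈ lam.cells ∧ c ∉ mu.cells}

/-- Periodic shapes. The last field: every column other than the left-most and the right-most
one has a cell whose left and right neighbours both belong to the shape. -/
structure IsPeriodicShape (P : Set (ℤ × ℤ)) : Prop where
  one_mem : ((1, 1) : ℤ × ℤ) ∈ P
  skew : IsFrenchSkewShape P
  connected : IsConnectedShape P
  column : ∀ j : ℤ, (∃ i, (i, j) ∈ P) → (∃ x ∈ P, x.2 < j) → (∃ x ∈ P, j < x.2) →
    ∃ i, (i, j) ∈ P ∧ (i, j - 1) ∈ P ∧ (i, j + 1) ∈ P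

/-- The index of the top row. -/
noncomputable def topRow (P : Set (ℤ × ℤ)) : ℤ := sInf (Prod.fst '' P)

/-- The index of the bottom row. -/
noncomputable def bottomRow (P : Set (ℤ × ℤ)) : ℤ := sSup (Prod.fst '' P)

/-- The left-most cell of the top row. -/
noncomputable def topLeft (P : Set (ℤ × ℤ)) : ℤ × ℤ := (topRow P, sInf {j | (topRow P, j) ∈ P})

/-- The left-most cell of the bottom row. -/
noncomputable def bottomLeft (P : Set (ℤ × ℤ)) : ℤ × ℤ :=
  (bottomRow P, sInf {j | (bottomRow P, j) ∈ P})

/-- The shift vector `b - a + (1, w)`. -/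
noncomputable def shiftVector (P : Set (ℤ × ℤ)) (w : ℕ) : ℤ × ℤ :=
  bottomLeft P - topLeft P + (1, (w : ℤ))

/-- `Sh^w(P, m)`: the union of the `m` copies of `P` translated by `0, 1, …, m - 1` times the
shift vector. -/
noncomputable def Sh (P : Set (ℤ × ℤ)) (w m : ℕ) : Set (ℤ × ℤ) :=
  ⋃ i ∈ Finset.range m, translate P ((i : ℤ) • shiftVector P w)

/-- `P` and `w` are compatible. -/
structure Compatible (P : Set (ℤ × ℤ)) (w : ℕ) : Prop where
  periodic : ∀ n, 1 ≤ n → IsPeriodicShape (Sh P w n)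
  bounded : ∃ K : ℕ, ∀ n, 1 ≤ n → ∀ j : ℤ, {x | x ∈ Sh P w n ∧ x.2 = j}.ncard ≤ K

/-- The corner of `S` generated by the cell `u`: the cell `u`, and the cells of `S` which are not
below the row of `u` and are strictly to the right of the column of `u`. -/
def corner (S : Set (ℤ × ℤ)) (u : ℤ × ℤ) : Set (ℤ × ℤ) :=
  {x | x ∈ S ∧ (x = u ∨ (x.1 ≤ u.1 ∧ u.2 < x.2))}

/-- The translate whose top row is row `1` and whose left-most column is column `1`. -/
noncomputable def normalize (S : Set (ℤ × ℤ)) : Set (ℤ × ℤ) :=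
  translate S (1 - sInf (Prod.fst '' S), 1 - sInf (Prod.snd '' S))

/-- The left-most cell of the top row of the last copy of `P` in `Sh^w(P, m)`. -/
noncomputable def lastTopLeft (P : Set (ℤ × ℤ)) (w m : ℕ) : ℤ × ℤ :=
  topLeft (translate P (((m : ℤ) - 1) • shiftVector P w))

/-- The cell `u` with `u - ∇ = v - (1, 0)`, where `∇` is the shift vector and `v` is the left-most
cell of the top row of the last copy of `P` in `Sh^w(P, m)`; it lies in the bottom row of
`Sh^w(P, m)`, directly above the first cell of the next copy of `P`. -/
noncomputable def cornerCell (P : Set (ℤ × ℤ)) (w m : ℕ) : ℤ × ℤ :=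
  lastTopLeft P w m - (1, 0) + shiftVector P w

/-- The index shape `I(P, w)`: the common value, for all sufficiently large `m`, of the normalized
corner of `Sh^w(P, m)` generated by `cornerCell P w m`. -/
noncomputable def indexShape (P : Set (ℤ × ℤ)) (w : ℕ) : Set (ℤ × ℤ) :=
  {x | ∀ᶠ m : ℕ in Filter.atTop, x ∈ normalize (corner (Sh P w m) (cornerCell P w m))}

/-- `dim(P, w) = |SYT(I(P, w))|`. -/
noncomputable def dim (P : Set (ℤ × ℤ)) (w : ℕ) : ℕ := (SYT (indexShape P w)).ncard

/-- `N(P, w)`: the smallest positive `m` such that `Sh^w(P, m)` contains a translate of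
`I(P, w)`. -/
noncomputable def threshold (P : Set (ℤ × ℤ)) (w : ℕ) : ℕ :=
  sInf {m | 1 ≤ m ∧ ∃ v : ℤ × ℤ, translate (indexShape P w) v ⊆ Sh P w m}

/-- `P_w(n) = |SYT(Sh^w(P, n))|`. -/
noncomputable def count (P : Set (ℤ × ℤ)) (w n : ℕ) : ℕ := (SYT (Sh P w n)).ncard

end PeriodicSYT

/-! The proof is a transfer-matrix argument. A tableau of a finite shape amounts to a linear
extension of its adjacency order (`ncard_SYT`), and unlike fillings these restrict to subshapes
without renumbering.

Write `d` for the shift vector and `a` for the first cell of `P`. Translate `Sh P w n` so that the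
next copy to be attached is `P` itself: the old copies form `past P d n`, and the index shape
becomes a fixed set `F = frontier P d u` with `u = a - (1, 0)`. In a connected French skew shape a
cell weakly below and to the right of another is reached by right and down steps
(`reflTransGen_step`). Hence every old cell outside `F`, being weakly above and to the left of `u`,
precedes `u`, while every cell of `P` equals or follows `a`, which lies directly below `u`. So a
linear extension of `past P d n ∪ P` is a pair of linear extensions of `past P d n` and of `F ∪ P`
agreeing on `F` (`card_linExt_union`).

As `F + d ⊆ F ∪ P`, the numbers of extensions of `past P d n` with prescribed restriction to `F`
form a vector indexed by `LinExt F`, of size `dim P w`, which a fixed matrix advances as soon as `F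
⊆ past P d n` (`Layout.transfer`). Cayley–Hamilton gives the recurrence
(`exists_recurrence_of_transfer`), and `Layout.threshold_spec` shows that `threshold P w` is late
enough to start. -/

namespace PeriodicSYT

/-! ### Linear extensions as relations: restriction and translation -/

/-- `y` is the right or the lower neighbour of `x`. -/
def Covers (x y : ℤ × ℤ) : Prop := y = x + (0, 1) ∨ y = x + (1, 0)

/-- `R` is (the graph of) a strict total order on `S` that extends the adjacency order. -/
structure IsLinExt (S : Set (ℤ × ℤ)) (R : Set ((ℤ × ℤ) × (ℤ × ℤ))) : Prop where
  mem : ∀ {x y}, (x, y) ∈ R → x ∈ S ∧ y ∈ S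
  irrefl : ∀ x, (x, x) ∉ R
  trans : ∀ {x y z}, (x, y) ∈ R → (y, z) ∈ R → (x, z) ∈ R
  total : ∀ {x y}, x ∈ S → y ∈ S → x ≠ y → (x, y) ∈ R ∨ (y, x) ∈ R
  covers : ∀ {x y}, x ∈ S → y ∈ S → Covers x y → (x, y) ∈ R

/-- The set of linear extensions of `S`. -/
def LinExt (S : Set (ℤ × ℤ)) : Set (Set ((ℤ × ℤ) × (ℤ × ℤ))) := {R | IsLinExt S R}

/-- The restriction of a relation to a set of cells. -/
def restrict (T : Set (ℤ × ℤ)) (R : Set ((ℤ × ℤ) × (ℤ × ℤ))) : Set ((ℤ × ℤ) × (ℤ × ℤ)) :=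
  {p | p ∈ R ∧ p.1 ∈ T ∧ p.2 ∈ T}

/-- The translate of a relation. -/
def shift (v : ℤ × ℤ) (R : Set ((ℤ × ℤ) × (ℤ × ℤ))) : Set ((ℤ × ℤ) × (ℤ × ℤ)) :=
  {p | (p.1 - v, p.2 - v) ∈ R}

theorem mem_translate {S : Set (ℤ × ℤ)} {v x : ℤ × ℤ} : x ∈ translate S v ↔ x - v ∈ S := by
  constructor
  · rintro ⟨y, hy, rfl⟩
    simpa using hy
  · intro h
    exact ⟨x - v, h, by simp⟩

theorem translate_translate (S : Set (ℤ × ℤ)) (v v' : ℤ × ℤ) :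
    translate (translate S v) v' = translate S (v + v') := by
  ext x
  simp only [mem_translate, sub_add_eq_sub_sub_swap]

theorem translate_zero (S : Set (ℤ × ℤ)) : translate S 0 = S := by
  ext x
  simp [mem_translate]

theorem restrict_restrict {T T' : Set (ℤ × ℤ)} (h : T ⊆ T') (R : Set ((ℤ × ℤ) × (ℤ × ℤ))) :
    restrict T (restrict T' R) = restrict T R := by
  ext p
  simp only [restrict, Set.mem_ofPred_eq]
  exact ⟨fun hp => ⟨hp.1.1, hp.2⟩, fun hp => ⟨⟨hp.1, h hp.2.1, h hp.2.2⟩, hp.2⟩⟩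

theorem shift_shift (v v' : ℤ × ℤ) (R : Set ((ℤ × ℤ) × (ℤ × ℤ))) :
    shift v (shift v' R) = shift (v + v') R := by
  ext p
  simp only [shift, Set.mem_ofPred_eq, sub_sub]

theorem shift_zero (R : Set ((ℤ × ℤ) × (ℤ × ℤ))) : shift 0 R = R := by
  ext p
  simp [shift]

theorem restrict_translate_shift (T : Set (ℤ × ℤ)) (v : ℤ × ℤ)
    (R : Set ((ℤ × ℤ) × (ℤ × ℤ))) :
    restrict (translate T v) (shift v R) = shift v (restrict T R) := by
  ext p
  simp only [restrict, shift, Set.mem_ofPred_eq, mem_translate]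

theorem IsLinExt.restrict {S T : Set (ℤ × ℤ)} {R : Set ((ℤ × ℤ) × (ℤ × ℤ))} (h : IsLinExt S R)
    (hT : T ⊆ S) : IsLinExt T (restrict T R) where
  mem hp := hp.2
  irrefl x hp := h.irrefl x hp.1
  trans hp hq := ⟨h.trans hp.1 hq.1, hp.2.1, hq.2.2⟩
  total hx hy hne := (h.total (hT hx) (hT hy) hne).imp (fun hp => ⟨hp, hx, hy⟩)
    (fun hp => ⟨hp, hy, hx⟩)
  covers hx hy hc := ⟨h.covers (hT hx) (hT hy) hc, hx, hy⟩

theorem Covers.sub {x y : ℤ × ℤ} (h : Covers x y) (v : ℤ × ℤ) : Covers (x - v) (y - v) := by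
  rcases h with rfl | rfl
  · exact Or.inl (by abel)
  · exact Or.inr (by abel)

theorem IsLinExt.shift {S : Set (ℤ × ℤ)} {R : Set ((ℤ × ℤ) × (ℤ × ℤ))} (h : IsLinExt S R)
    (v : ℤ × ℤ) : IsLinExt (translate S v) (shift v R) where
  mem hp := ⟨mem_translate.2 (h.mem hp).1, mem_translate.2 (h.mem hp).2⟩
  irrefl _ hp := h.irrefl _ hp
  trans hp hq := h.trans hp hq
  total hx hy hne := h.total (mem_translate.1 hx) (mem_translate.1 hy)
    (fun e => hne (sub_left_injective e))
  covers hx hy hc := h.covers (mem_translate.1 hx) (mem_translate.1 hy) (hc.sub v)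

theorem shift_mem_linExt {S : Set (ℤ × ℤ)} {R : Set ((ℤ × ℤ) × (ℤ × ℤ))} {v : ℤ × ℤ} :
    shift v R ∈ LinExt (translate S v) ↔ R ∈ LinExt S := by
  refine ⟨fun h => ?_, fun h => IsLinExt.shift h v⟩
  have := IsLinExt.shift h (-v)
  rwa [translate_translate, shift_shift, add_neg_cancel, neg_add_cancel, translate_zero,
    shift_zero] at this

/-- Translation as a permutation of the relations. -/
def shiftEquiv (v : ℤ × ℤ) :
    Set ((ℤ × ℤ) × (ℤ × ℤ)) ≃ Set ((ℤ × ℤ) × (ℤ × ℤ)) where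
  toFun := shift v
  invFun := shift (-v)
  left_inv R := by rw [shift_shift, neg_add_cancel, shift_zero]
  right_inv R := by rw [shift_shift, add_neg_cancel, shift_zero]

theorem ncard_linExt_translate (S : Set (ℤ × ℤ)) (v : ℤ × ℤ) :
    (LinExt (translate S v)).ncard = (LinExt S).ncard :=
  (Nat.card_congr ((shiftEquiv v).subtypeEquiv fun _ => shift_mem_linExt.symm)).symm

theorem finite_linExt {S : Set (ℤ × ℤ)} (hS : S.Finite) : (LinExt S).Finite :=
  (hS.prod hS).finite_subsets.subset fun _ hR _ hp => Set.mem_prod.2 (IsLinExt.mem hR hp)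

/-- Order the cells by `i + j`, breaking ties by the row. Positivity of the counts later yields a
nonzero coefficient in the recurrence. -/
theorem linExt_nonempty (S : Set (ℤ × ℤ)) : (LinExt S).Nonempty := by
  refine ⟨{p | p.1 ∈ S ∧ p.2 ∈ S ∧ (p.1.1 + p.1.2 < p.2.1 + p.2.2 ∨
    p.1.1 + p.1.2 = p.2.1 + p.2.2 ∧ p.1.1 < p.2.1)}, ?_, ?_, ?_, ?_, ?_⟩
  · rintro x y ⟨hx, hy, -⟩
    exact ⟨hx, hy⟩
  · rintro x ⟨-, -, h⟩
    simp at h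
  · rintro x y z ⟨hx, hy, h⟩ ⟨-, hz, h'⟩
    refine ⟨hx, hz, ?_⟩
    dsimp only at *
    omega
  · intro x y hx hy hne
    by_contra! hc
    have h1 := mt (fun h => ⟨hx, hy, h⟩) hc.1
    have h2 := mt (fun h => ⟨hy, hx, h⟩) hc.2
    dsimp only at h1 h2
    exact hne (Prod.ext (by omega) (by omega))
  · rintro x y hx hy (rfl | rfl)
    · refine ⟨hx, hy, Or.inl ?_⟩
      simp
    · refine ⟨hx, hy, Or.inl ?_⟩
      simp [add_right_comm]

/-! ### Standard tableaux and linear extensions -/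

/-- The order of the cells of `S` given by a filling. -/
def fillingOrder {S : Set (ℤ × ℤ)} (f : S → ℕ) : Set ((ℤ × ℤ) × (ℤ × ℤ)) :=
  {p | ∃ (hx : p.1 ∈ S) (hy : p.2 ∈ S), f ⟨p.1, hx⟩ < f ⟨p.2, hy⟩}

theorem IsPartialTableau.isLinExt {S : Set (ℤ × ℤ)} {f : S → ℕ} (hf : IsPartialTableau S f) :
    IsLinExt S (fillingOrder f) where
  mem := fun ⟨hx, hy, _⟩ => ⟨hx, hy⟩
  irrefl := fun _ ⟨_, _, h⟩ => lt_irrefl _ h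
  trans := fun ⟨hx, _, h⟩ ⟨_, hz, h'⟩ => ⟨hx, hz, h.trans h'⟩
  total := fun {x y} hx hy hne => by
    have : f ⟨x, hx⟩ ≠ f ⟨y, hy⟩ := fun e => hne (congrArg Subtype.val (hf.injective e))
    exact this.lt_or_gt.imp (fun h => ⟨hx, hy, h⟩) (fun h => ⟨hy, hx, h⟩)
  covers := by
    rintro ⟨i, j⟩ y hx hy (rfl | rfl)
    · refine ⟨hx, hy, ?_⟩
      simp only [Prod.mk_add_mk, add_zero] at hy ⊢
      exact hf.row_lt i j hx hy
    · refine ⟨hx, hy, ?_⟩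
      simp only [Prod.mk_add_mk, add_zero] at hy ⊢
      exact hf.col_lt i j hx hy

/-- An injection into `{1, …, |S|}` is onto, so each entry is the rank of its cell; a tableau is
therefore recovered from the order it induces. -/
theorem eq_ncard_of_mem_SYT {S : Set (ℤ × ℤ)} (hS : S.Finite) {f : S → ℕ} (hf : f ∈ SYT S)
    (x : S) : f x = {y | f y ≤ f x}.ncard := by
  have := hS.to_subtype
  have hr : Set.range f = Set.Icc 1 S.ncard := by
    refine Set.eq_of_subset_of_ncard_le ?_ ?_ (Set.finite_Icc _ _)
    · rintro _ ⟨y, rfl⟩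
      exact hf.2 y
    · rw [← Set.image_univ, Set.ncard_image_of_injective _ hf.1.injective, Set.ncard_univ,
        Nat.card_coe_set_eq, Set.ncard_eq_toFinset_card']
      simp
  have hi : f '' {y | f y ≤ f x} = Set.Icc 1 (f x) := by
    ext k
    constructor
    · rintro ⟨y, hy, rfl⟩
      exact ⟨(hf.2 y).1, hy⟩
    · rintro ⟨h1, h2⟩
      obtain ⟨y, rfl⟩ : k ∈ Set.range f := hr ▸ ⟨h1, h2.trans (hf.2 x).2⟩
      exact ⟨y, h2, rfl⟩
  rw [← Set.ncard_image_of_injective _ hf.1.injective, hi, Set.ncard_eq_toFinset_card']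
  simp

theorem fillingOrder_injOn {S : Set (ℤ × ℤ)} (hS : S.Finite) :
    Set.InjOn (fillingOrder (S := S)) (SYT S) := by
  intro f hf g hg h
  have key : ∀ x y : S, f y ≤ f x ↔ g y ≤ g x := by
    intro x y
    have := Set.ext_iff.1 h (x.1, y.1)
    simp only [fillingOrder, Set.mem_ofPred_eq, Subtype.coe_eta, Subtype.coe_prop,
      exists_true_left] at this
    rw [← not_lt, ← not_lt, this]
  funext x
  rw [eq_ncard_of_mem_SYT hS hf, eq_ncard_of_mem_SYT hS hg]
  simp only [key]

theorem IsLinExt.exists_fillingOrder_eq {S : Set (ℤ × ℤ)} (hS : S.Finite)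
    {R : Set ((ℤ × ℤ) × (ℤ × ℤ))} (hR : IsLinExt S R) : ∃ f ∈ SYT S, fillingOrder f = R := by
  have := hS.to_subtype
  let f : S → ℕ := fun x => {y : S | (y.1, x.1) ∈ R}.ncard + 1
  have hlt : ∀ x y : S, (x.1, y.1) ∈ R → f x < f y := by
    intro x y h
    refine Nat.succ_lt_succ (Set.ncard_lt_ncard ?_ (Set.toFinite _))
    refine ⟨fun z hz => hR.trans hz h, fun hs => hR.irrefl x.1 (hs h)⟩
  have hiff : ∀ x y : S, f x < f y ↔ (x.1, y.1) ∈ R := by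
    refine fun x y => ⟨fun h => ?_, hlt x y⟩
    by_contra hc
    by_cases e : x = y
    · exact h.ne (congrArg f e)
    · rcases hR.total x.2 y.2 (fun e' => e (Subtype.ext e')) with h' | h'
      · exact hc h'
      · exact h.asymm (hlt _ _ h')
  refine ⟨f, ⟨⟨fun x => Nat.succ_pos _, fun x y h => ?_, fun i j h h' => ?_, fun i j h h' => ?_⟩,
    fun x => ⟨Nat.succ_pos _, ?_⟩⟩, ?_⟩
  · by_contra e
    rcases hR.total x.2 y.2 (fun e' => e (Subtype.ext e')) with h' | h'
    · exact (hlt _ _ h').ne h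
    · exact (hlt _ _ h').ne' h
  · exact hlt _ _ (hR.covers h h' (Or.inl (by simp)))
  · exact hlt _ _ (hR.covers h h' (Or.inr (by simp)))
  · rw [← Nat.card_coe_set_eq S, ← Set.ncard_univ]
    refine Nat.succ_le_of_lt (Set.ncard_lt_ncard ?_ (Set.toFinite _))
    exact ⟨Set.subset_univ _, fun hs => hR.irrefl x.1 (hs (Set.mem_univ x))⟩
  · ext ⟨x, y⟩
    exact ⟨fun ⟨hx, hy, h⟩ => (hiff ⟨x, hx⟩ ⟨y, hy⟩).1 h,
      fun h => ⟨(hR.mem h).1, (hR.mem h).2, (hiff ⟨x, _⟩ ⟨y, _⟩).2 h⟩⟩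

theorem ncard_SYT {S : Set (ℤ × ℤ)} (hS : S.Finite) : (SYT S).ncard = (LinExt S).ncard := by
  rw [← (fillingOrder_injOn hS).ncard_image]
  congr 1
  ext R
  constructor
  · rintro ⟨f, hf, rfl⟩
    exact hf.1.isLinExt
  · intro hR
    exact IsLinExt.exists_fillingOrder_eq hS hR

/-! ### Gluing linear extensions along a separating cell -/

/-- The relation on `S ∪ J` obtained from relations on `S` and `J` by placing the cells of `S \ J`
before the cells of `J \ S`. -/
def glue (S J : Set (ℤ × ℤ)) (σ π : Set ((ℤ × ℤ) × (ℤ × ℤ))) : Set ((ℤ × ℤ) × (ℤ × ℤ)) :=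
  {p | p ∈ σ ∨ p ∈ π ∨ (p.1 ∈ S \ J ∧ p.2 ∈ J \ S)}

section Glue

variable {S J : Set (ℤ × ℤ)} {σ π : Set ((ℤ × ℤ) × (ℤ × ℤ))} {u : ℤ × ℤ}

theorem restrict_glue_left (hσ : IsLinExt S σ) (hπ : IsLinExt J π)
    (h : restrict (S ∩ J) σ = restrict (S ∩ J) π) : restrict S (glue S J σ π) = σ := by
  ext ⟨x, y⟩
  constructor
  · rintro ⟨h1 | h1 | h1, hx, hy⟩
    · exact h1
    · have := hπ.mem h1
      exact (h.symm ▸ (⟨h1, ⟨hx, this.1⟩, ⟨hy, this.2⟩⟩ : (x, y) ∈ restrict (S ∩ J) π) :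
        (x, y) ∈ restrict (S ∩ J) σ).1
    · exact absurd hy h1.2.2
  · exact fun h1 => ⟨Or.inl h1, hσ.mem h1⟩

theorem restrict_glue_right (hσ : IsLinExt S σ) (hπ : IsLinExt J π)
    (h : restrict (S ∩ J) σ = restrict (S ∩ J) π) : restrict J (glue S J σ π) = π := by
  ext ⟨x, y⟩
  constructor
  · rintro ⟨h1 | h1 | h1, hx, hy⟩
    · have := hσ.mem h1
      exact (h ▸ (⟨h1, ⟨this.1, hx⟩, ⟨this.2, hy⟩⟩ : (x, y) ∈ restrict (S ∩ J) σ) :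
        (x, y) ∈ restrict (S ∩ J) π).1
    · exact h1
    · exact absurd hx h1.1.2
  · exact fun h1 => ⟨Or.inr (Or.inl h1), hπ.mem h1⟩

/-- Since `u` lies after `S \ J` and before `J \ S`, placing the former before the latter is
consistent with both orders. The hypothesis `hc` excludes the only adjacencies that would oppose
this placement. -/
theorem isLinExt_glue (hσ : IsLinExt S σ) (hπ : IsLinExt J π)
    (h : restrict (S ∩ J) σ = restrict (S ∩ J) π) (hu : u ∈ S ∩ J)
    (hS : ∀ x ∈ S \ J, (x, u) ∈ σ) (hJ : ∀ y ∈ J \ S, (u, y) ∈ π)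
    (hc : ∀ y ∈ J \ S, ∀ x ∈ S, ¬ Covers y x) : IsLinExt (S ∪ J) (glue S J σ π) := by
  have toπ : ∀ {x y}, (x, y) ∈ σ → x ∈ J → y ∈ J → (x, y) ∈ π := by
    intro x y h1 hx hy
    have h2 := hσ.mem h1
    exact (h ▸ (⟨h1, ⟨h2.1, hx⟩, ⟨h2.2, hy⟩⟩ : (x, y) ∈ restrict (S ∩ J) σ) :
        (x, y) ∈ restrict (S ∩ J) π).1
  have toσ : ∀ {x y}, (x, y) ∈ π → x ∈ S → y ∈ S → (x, y) ∈ σ := by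
    intro x y h1 hx hy
    have h2 := hπ.mem h1
    exact (h.symm ▸ (⟨h1, ⟨hx, h2.1⟩, ⟨hy, h2.2⟩⟩ : (x, y) ∈ restrict (S ∩ J) π) :
        (x, y) ∈ restrict (S ∩ J) σ).1
  have hσπ : ∀ {x y z}, (x, y) ∈ σ → (y, z) ∈ π → (x, z) ∈ glue S J σ π := by
    intro x y z h1 h2
    by_cases hx : x ∈ J
    · exact Or.inr (Or.inl (hπ.trans (toπ h1 hx (hπ.mem h2).1) h2))
    by_cases hz : z ∈ S
    · exact Or.inl (hσ.trans h1 (toσ h2 (hσ.mem h1).2 hz))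
    exact Or.inr (Or.inr ⟨⟨(hσ.mem h1).1, hx⟩, (hπ.mem h2).2, hz⟩)
  refine ⟨?_, ?_, ?_, ?_, ?_⟩
  · rintro x y (h1 | h1 | h1)
    · exact ⟨Or.inl (hσ.mem h1).1, Or.inl (hσ.mem h1).2⟩
    · exact ⟨Or.inr (hπ.mem h1).1, Or.inr (hπ.mem h1).2⟩
    · exact ⟨Or.inl h1.1.1, Or.inr h1.2.1⟩
  · rintro x (h1 | h1 | h1)
    · exact hσ.irrefl x h1
    · exact hπ.irrefl x h1
    · exact h1.1.2 h1.2.1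
  · rintro x y z (h1 | h1 | h1) (h2 | h2 | h2)
    · exact Or.inl (hσ.trans h1 h2)
    · exact hσπ h1 h2
    · exact hσπ (hσ.trans h1 (hS _ h2.1)) (hJ _ h2.2)
    · have hy := (hσ.mem h2).1
      by_cases hx : x ∈ S
      · exact Or.inl (hσ.trans (toσ h1 hx hy) h2)
      by_cases hz : z ∈ J
      · exact Or.inr (Or.inl (hπ.trans h1 (toπ h2 (hπ.mem h1).2 hz)))
      -- Here `x ∈ J \ S` and `z ∈ S \ J`, so the chain `u, x, y, z, u` would be a cycle.
      have h3 : (u, y) ∈ σ := toσ (hπ.trans (hJ x ⟨(hπ.mem h1).1, hx⟩) h1) hu.1 hy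
      exact absurd (hσ.trans (hσ.trans h3 h2) (hS z ⟨(hσ.mem h2).2, hz⟩)) (hσ.irrefl u)
    · exact Or.inr (Or.inl (hπ.trans h1 h2))
    · exact absurd (hπ.mem h1).2 h2.1.2
    · exact absurd (hσ.mem h2).1 h1.2.2
    · exact hσπ (hS _ h1.1) (hπ.trans (hJ _ h1.2) h2)
    · exact absurd h1.2.1 h2.1.2
  · intro x y hx hy hne
    by_cases hxS : x ∈ S <;> by_cases hyS : y ∈ S
    · exact (hσ.total hxS hyS hne).imp Or.inl Or.inl
    · have hyJ := hy.resolve_left hyS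
      by_cases hxJ : x ∈ J
      · exact (hπ.total hxJ hyJ hne).imp (Or.inr ∘ Or.inl) (Or.inr ∘ Or.inl)
      · exact Or.inl (Or.inr (Or.inr ⟨⟨hxS, hxJ⟩, hyJ, hyS⟩))
    · have hxJ := hx.resolve_left hxS
      by_cases hyJ : y ∈ J
      · exact (hπ.total hxJ hyJ hne).imp (Or.inr ∘ Or.inl) (Or.inr ∘ Or.inl)
      · exact Or.inr (Or.inr (Or.inr ⟨⟨hyS, hyJ⟩, hxJ, hxS⟩))
    · exact (hπ.total (hx.resolve_left hxS) (hy.resolve_left hyS) hne).imp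
        (Or.inr ∘ Or.inl) (Or.inr ∘ Or.inl)
  · intro x y hx hy hxy
    by_cases hxS : x ∈ S <;> by_cases hyS : y ∈ S
    · exact Or.inl (hσ.covers hxS hyS hxy)
    · have hyJ := hy.resolve_left hyS
      by_cases hxJ : x ∈ J
      · exact Or.inr (Or.inl (hπ.covers hxJ hyJ hxy))
      · exact Or.inr (Or.inr ⟨⟨hxS, hxJ⟩, hyJ, hyS⟩)
    · exact absurd hxy (hc x ⟨hx.resolve_left hxS, hxS⟩ y hyS)
    · exact Or.inr (Or.inl (hπ.covers (hx.resolve_left hxS) (hy.resolve_left hyS) hxy))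

/-- Comparisons between `S \ J` and `J \ S` are forced through `u`; every other pair lies within `S`
or within `J`. -/
theorem eq_glue_restrict {ρ : Set ((ℤ × ℤ) × (ℤ × ℤ))} (hρ : IsLinExt (S ∪ J) ρ)
    (hS : ∀ x ∈ S \ J, (x, u) ∈ ρ) (hJ : ∀ y ∈ J \ S, (u, y) ∈ ρ) :
    ρ = glue S J (restrict S ρ) (restrict J ρ) := by
  ext ⟨x, y⟩
  constructor
  · intro h
    obtain ⟨hx, hy⟩ := hρ.mem h
    by_cases hxS : x ∈ S <;> by_cases hyS : y ∈ S
    · exact Or.inl ⟨h, hxS, hyS⟩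
    · have hyJ := hy.resolve_left hyS
      by_cases hxJ : x ∈ J
      · exact Or.inr (Or.inl ⟨h, hxJ, hyJ⟩)
      · exact Or.inr (Or.inr ⟨⟨hxS, hxJ⟩, hyJ, hyS⟩)
    · have hxJ := hx.resolve_left hxS
      by_cases hyJ : y ∈ J
      · exact Or.inr (Or.inl ⟨h, hxJ, hyJ⟩)
      · exact absurd (hρ.trans h (hρ.trans (hS y ⟨hyS, hyJ⟩) (hJ x ⟨hxJ, hxS⟩))) (hρ.irrefl x)
    · exact Or.inr (Or.inl ⟨h, hx.resolve_left hxS, hy.resolve_left hyS⟩)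
  · rintro (h | h | h)
    · exact h.1
    · exact h.1
    · exact hρ.trans (hS _ h.1) (hJ _ h.2)

end Glue

/-- A linear extension of `S ∪ J` is the same as a pair of linear extensions of `S` and `J` that
agree on `I = S ∩ J`, when a cell `u` of `I` separates `S \ J` from `J \ S`. -/
theorem card_linExt_union {S J I T : Set (ℤ × ℤ)} {u : ℤ × ℤ} (hSf : S.Finite) (hJf : J.Finite)
    (hI : S ∩ J = I) (hu : u ∈ I)
    (hS : ∀ σ ∈ LinExt S, ∀ x ∈ S \ J, (x, u) ∈ σ) (hJ : ∀ π ∈ LinExt J, ∀ y ∈ J \ S, (u, y) ∈ π)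
    (hc : ∀ y ∈ J \ S, ∀ x ∈ S, ¬ Covers y x) (hT : T ⊆ J) [Fintype (LinExt I)]
    (τ : Set ((ℤ × ℤ) × (ℤ × ℤ))) :
    {ρ | ρ ∈ LinExt (S ∪ J) ∧ restrict T ρ = τ}.ncard =
      ∑ κ : LinExt I, {π | π ∈ LinExt J ∧ restrict I π = κ ∧ restrict T π = τ}.ncard *
        {σ | σ ∈ LinExt S ∧ restrict I σ = κ}.ncard := by
  subst hI
  have fJ (κ : LinExt (S ∩ J)) :
      Finite {π | π ∈ LinExt J ∧ restrict (S ∩ J) π = κ ∧ restrict T π = τ} :=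
    ((finite_linExt hJf).subset fun _ h => h.1).to_subtype
  have fS (κ : LinExt (S ∩ J)) : Finite {σ | σ ∈ LinExt S ∧ restrict (S ∩ J) σ = κ} :=
    ((finite_linExt hSf).subset fun _ h => h.1).to_subtype
  simp only [← Nat.card_coe_set_eq, ← Nat.card_prod]
  rw [← Nat.card_sigma]
  refine Nat.card_congr (Equiv.ofBijective (fun ρ =>
    ⟨⟨restrict (S ∩ J) ρ.1, IsLinExt.restrict ρ.2.1 fun x hx => Or.inl hx.1⟩,
      ⟨restrict J ρ.1, IsLinExt.restrict ρ.2.1 fun x hx => Or.inr hx,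
        restrict_restrict Set.inter_subset_right _, by
          rw [restrict_restrict hT, ρ.2.2]⟩,
      ⟨restrict S ρ.1, IsLinExt.restrict ρ.2.1 fun x hx => Or.inl hx,
        restrict_restrict Set.inter_subset_left _⟩⟩) ⟨?_, ?_⟩)
  · intro ρ ρ' h
    have h1 := congrArg (fun s => s.2.1.1) h
    have h2 := congrArg (fun s => s.2.2.1) h
    dsimp only at h1 h2
    have key (ρ : {ρ | ρ ∈ LinExt (S ∪ J) ∧ restrict T ρ = τ}) :
        ρ.1 = glue S J (restrict S ρ.1) (restrict J ρ.1) :=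
      eq_glue_restrict (u := u) ρ.2.1
        (fun x hx => (hS _ (IsLinExt.restrict ρ.2.1 fun x hx => Or.inl hx) x hx).1)
        (fun x hx => (hJ _ (IsLinExt.restrict ρ.2.1 fun x hx => Or.inr hx) x hx).1)
    apply Subtype.ext
    rw [key ρ, key ρ', h1, h2]
  · rintro ⟨⟨κ, hκ⟩, ⟨π, hπ, h1, h2⟩, ⟨σ, hσ, h3⟩⟩
    dsimp only at h1 h3
    have h : restrict (S ∩ J) σ = restrict (S ∩ J) π := h3.trans h1.symm
    have e1 := restrict_glue_left hσ hπ h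
    have e2 := restrict_glue_right hσ hπ h
    have e3 : restrict (S ∩ J) (glue S J σ π) = κ := by
      rw [← restrict_restrict Set.inter_subset_left, e1, h3]
    refine ⟨⟨glue S J σ π, isLinExt_glue hσ hπ h hu (hS σ hσ) (hJ π hπ) hc, ?_⟩, ?_⟩
    · rw [← restrict_restrict hT, e2, h2]
    · subst h1
      simp only [e1, e2]
      congr!
      exact Subtype.ext e3

/-! ### From a transfer matrix to a scalar recurrence -/

/-- Sequences driven by an integer matrix satisfy the recurrence of its characteristic
polynomial. -/
theorem exists_recurrence_of_transfer {ι : Type*} [Fintype ι] [DecidableEq ι]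
    (A : Matrix ι ι ℤ) (v : ℕ → ι → ℤ) (N : ℕ) (hv : ∀ n, N ≤ n → v (n + 1) = A.mulVec (v n))
    (hpos : ∑ k, v (N + Fintype.card ι) k ≠ 0) :
    ∃ r : ℕ, 1 ≤ r ∧ r ≤ Fintype.card ι ∧ ∃ c : ℕ → ℤ, c r ≠ 0 ∧
      ∀ n, N + Fintype.card ι ≤ n →
        ∑ k, v n k = ∑ i ∈ Finset.Icc 1 r, c i * ∑ k, v (n - i) k := by
  set d := Fintype.card ι with hd
  have hpow : ∀ k n, N ≤ n → (A ^ k).mulVec (v n) = v (n + k) := by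
    intro k
    induction k with
    | zero => simp
    | succ k ih =>
      intro n hn
      rw [pow_succ', ← Matrix.mulVec_mulVec, ih n hn, ← hv _ (by omega), add_assoc]
  rcases isEmpty_or_nonempty ι with he | hne
  · simp at hpos
  have hdeg : A.charpoly.natDegree = d := A.charpoly_natDegree_eq_dim
  -- Cayley–Hamilton, applied to `v n` and summed over the coordinates.
  have hch : ∀ n, N ≤ n →
      ∑ k ∈ Finset.range (d + 1), A.charpoly.coeff k * ∑ j, v (n + k) j = 0 := by
    intro n hn
    have h0 := A.aeval_self_charpoly
    rw [Polynomial.aeval_eq_sum_range, hdeg] at h0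
    have h1 := congrArg (fun M : Matrix ι ι ℤ => ∑ j, M.mulVec (v n) j) h0
    simp only [Matrix.sum_mulVec, Matrix.smul_mulVec, Finset.sum_apply, Pi.smul_apply, smul_eq_mul,
      hpow _ _ hn, Matrix.zero_mulVec, Pi.zero_apply, Finset.sum_const_zero] at h1
    rw [Finset.sum_comm] at h1
    simpa only [Finset.mul_sum] using h1
  have hlead : A.charpoly.coeff d = 1 := by
    rw [← hdeg]
    exact A.charpoly_monic.coeff_natDegree
  let c : ℕ → ℤ := fun i => -A.charpoly.coeff (d - i)
  have hrec : ∀ n, N + d ≤ n →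
      ∑ k, v n k = ∑ i ∈ Finset.Icc 1 d, c i * ∑ k, v (n - i) k := by
    intro n hn
    have h := hch (n - d) (by omega)
    rw [Finset.sum_range_succ, hlead, one_mul, Nat.sub_add_cancel (by omega),
      ← Finset.sum_range_reflect] at h
    have e : ∑ i ∈ Finset.Icc 1 d, c i * ∑ k, v (n - i) k =
        ∑ i ∈ Finset.range d, c (i + 1) * ∑ k, v (n - (i + 1)) k := by
      rw [Finset.range_eq_Ico, Finset.sum_Ico_add' (fun i => c i * ∑ k, v (n - i) k)]
      rfl
    rw [e, eq_neg_of_add_eq_zero_right h, ← Finset.sum_neg_distrib]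
    refine Finset.sum_congr rfl fun i hi => ?_
    have hi' := Finset.mem_range.1 hi
    rw [show n - d + (d - 1 - i) = n - (i + 1) by omega, show d - 1 - i = d - (i + 1) by omega,
      neg_mul]
  -- If all coefficients vanished, so would the sum at `N + d`. The order `r` is then the last index
  -- with `c r ≠ 0`.
  have hex : ((Finset.Icc 1 d).filter fun i => c i ≠ 0).Nonempty := by
    by_contra hcon
    refine hpos ((hrec _ le_rfl).trans (Finset.sum_eq_zero fun i hi => ?_))
    by_contra hi'
    exact hcon ⟨i, Finset.mem_filter.2 ⟨hi, left_ne_zero_of_mul hi'⟩⟩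
  obtain ⟨r, hr, hmax⟩ := Finset.exists_max_image _ id hex
  obtain ⟨hr, hcr⟩ := Finset.mem_filter.1 hr
  obtain ⟨hr1, hrd⟩ := Finset.mem_Icc.1 hr
  refine ⟨r, hr1, hrd, c, hcr, fun n hn => ?_⟩
  rw [hrec n hn]
  refine (Finset.sum_subset (Finset.Icc_subset_Icc_right hrd) fun i hi hi' => ?_).symm
  by_contra hi''
  have := hmax i (Finset.mem_filter.2 ⟨hi, left_ne_zero_of_mul hi''⟩)
  exact hi' (Finset.mem_Icc.2 ⟨(Finset.mem_Icc.1 hi).1, this⟩)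

/-! ### Monotone paths in connected skew shapes -/

/-- `S` contains, with two cells one of which is weakly above and weakly to the right of the other,
the rectangle they span. -/
def AntidiagonalConvex (S : Set (ℤ × ℤ)) : Prop :=
  ∀ ⦃x⦄, x ∈ S → ∀ ⦃y⦄, y ∈ S → ∀ ⦃z : ℤ × ℤ⦄, y.1 ≤ z.1 → z.1 ≤ x.1 → x.2 ≤ z.2 → z.2 ≤ y.2 →
    z ∈ S

/-- A step of `S` to the right or down. -/
def Step (S : Set (ℤ × ℤ)) (x y : ℤ × ℤ) : Prop := x ∈ S ∧ y ∈ S ∧ Covers x y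

/-- Flipping the rows turns the rectangle into an interval of the product order; `lam` is a lower
set, and `mu`, also a lower set, cannot meet the interval without containing its least element. -/
theorem IsFrenchSkewShape.antidiagonalConvex {S : Set (ℤ × ℤ)} (h : IsFrenchSkewShape S) :
    AntidiagonalConvex S := by
  obtain ⟨lam, mu, -, v, rfl⟩ := h
  rintro _ ⟨⟨c1, c2⟩, ⟨hc, hc'⟩, rfl⟩ _ ⟨⟨e1, e2⟩, ⟨he, he'⟩, rfl⟩ z h1 h2 h3 h4
  simp only [Prod.fst_add, Prod.snd_add] at h1 h2 h3 h4
  refine ⟨((v.1 - z.1).toNat, (z.2 - v.2).toNat), ⟨?_, fun hz => hc' ?_⟩,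
    Prod.ext (by simp; omega) (by simp; omega)⟩
  · exact lam.isLowerSet (Prod.mk_le_mk.2 ⟨by omega, by omega⟩) he
  · exact mu.isLowerSet (Prod.mk_le_mk.2 ⟨by omega, by omega⟩) hz

theorem IsFrenchSkewShape.finite {S : Set (ℤ × ℤ)} (h : IsFrenchSkewShape S) : S.Finite := by
  obtain ⟨lam, mu, -, v, rfl⟩ := h
  exact (lam.cells.finite_toSet.subset fun c hc => hc.1).image _

/-- In a connected skew shape there is a step from `x` towards any cell weakly below and weakly to
the right of `x`. -/
theorem exists_step {S : Set (ℤ × ℤ)} (hc : AntidiagonalConvex S) (hS : IsConnectedShape S)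
    {x y : ℤ × ℤ} (hx : x ∈ S) (hy : y ∈ S) (hxy : x ≤ y) (hne : x ≠ y) :
    ∃ z, Step S x z ∧ z ≤ y := by
  have h1 := hxy.1
  have h2 := hxy.2
  suffices h : (x.2 < y.2 ∧ x + (0, 1) ∈ S) ∨ (x.1 < y.1 ∧ x + (1, 0) ∈ S) by
    rcases h with ⟨h, h'⟩ | ⟨h, h'⟩
    · exact ⟨_, ⟨hx, h', Or.inl rfl⟩, by simpa using h1, by simpa using h⟩
    · exact ⟨_, ⟨hx, h', Or.inr rfl⟩, by simpa using h, by simpa using h2⟩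
  rcases h1.eq_or_lt with e1 | l1
  · have l2 : x.2 < y.2 := lt_of_le_of_ne h2 fun e2 => hne (Prod.ext e1 e2)
    exact Or.inl ⟨l2, hc hx hy (by simp; omega) (by simp) (by simp) (by simp; omega)⟩
  rcases h2.eq_or_lt with e2 | l2
  · exact Or.inr ⟨l1, hc hy hx (by simp) (by simp; omega) (by simp; omega) (by simp)⟩
  by_contra! hcon
  have hr := hcon.1 l2
  have hd := hcon.2 l1
  -- With both neighbours missing, no path from `x` leaves the quadrant above and to the left of
  -- `x`: the first cell outside it would span with `x` a rectangle containing a missing neighbour.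
  have key : y.1 ≤ x.1 ∧ y.2 ≤ x.2 := by
    have hpath := hS x hx y hy
    clear hxy hne h1 h2 l1 l2 hcon hy
    induction hpath with
    | refl => exact ⟨le_rfl, le_rfl⟩
    | @tail z z' _ hz ih =>
      obtain ⟨-, hz', hs⟩ := hz
      have hs1 : z'.1 = z.1 + (z' - z).1 := by simp
      have hs2 : z'.2 = z.2 + (z' - z).2 := by simp
      simp only [Set.mem_insert_iff, Set.mem_singleton_iff] at hs
      by_contra hn
      by_cases hb : x.1 < z'.1
      · refine hd (hc hz' hx (z := x + (1, 0)) ?_ ?_ ?_ ?_) <;>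
          rcases hs with e | e | e | e <;> simp [e] at hs1 hs2 ⊢ <;> omega
      · refine hr (hc hx hz' (z := x + (0, 1)) ?_ ?_ ?_ ?_) <;>
          rcases hs with e | e | e | e <;> simp [e] at hs1 hs2 ⊢ <;> omega
  omega

theorem reflTransGen_step {S : Set (ℤ × ℤ)} (hc : AntidiagonalConvex S) (hS : IsConnectedShape S)
    {x y : ℤ × ℤ} (hx : x ∈ S) (hy : y ∈ S) (hxy : x ≤ y) :
    Relation.ReflTransGen (Step S) x y := by
  induction hk : (y.1 - x.1 + (y.2 - x.2)).toNat using Nat.strong_induction_on generalizing x with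
  | _ k ih =>
    by_cases hne : x = y
    · rw [hne]
    obtain ⟨z, hz, hzy⟩ := exists_step hc hS hx hy hxy hne
    refine Relation.ReflTransGen.head hz (ih _ ?_ hz.2.1 hzy rfl)
    have h1 := hzy.1
    have h2 := hzy.2
    have h3 := hxy.1
    have h4 := hxy.2
    rcases hz.2.2 with rfl | rfl <;> simp at h1 h2 ⊢ <;> omega

theorem IsLinExt.of_path {S T : Set (ℤ × ℤ)} {R : Set ((ℤ × ℤ) × (ℤ × ℤ))} (hR : IsLinExt S R)
    (hT : T ⊆ S) {x y : ℤ × ℤ} (h : Relation.ReflTransGen (Step T) x y) :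
    x = y ∨ (x, y) ∈ R := by
  induction h with
  | refl => exact Or.inl rfl
  | tail _ hs ih =>
    have h1 := hR.covers (hT hs.1) (hT hs.2.1) hs.2.2
    rcases ih with rfl | ih
    · exact Or.inr h1
    · exact Or.inr (hR.trans ih h1)

theorem Step.translate {S : Set (ℤ × ℤ)} {x y : ℤ × ℤ} (v : ℤ × ℤ) (h : Step S x y) :
    Step (translate S v) (x + v) (y + v) := by
  refine ⟨mem_translate.2 (by simpa using h.1), mem_translate.2 (by simpa using h.2.1), ?_⟩
  rcases h.2.2 with rfl | rfl
  · exact Or.inl (by abel)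
  · exact Or.inr (by abel)

/-! ### Stacked copies of the shape and their frontier -/

/-- The union of the translates of `P` by `-d, -2d, …, -nd`. -/
def past (P : Set (ℤ × ℤ)) (d : ℤ × ℤ) (n : ℕ) : Set (ℤ × ℤ) :=
  {x | ∃ k : ℕ, 1 ≤ k ∧ k ≤ n ∧ x + (k : ℤ) • d ∈ P}

/-- The cell `u`, and the cells to the right of the column of `u` of all translates of `P` by
negative multiples of `d`. -/
def frontier (P : Set (ℤ × ℤ)) (d u : ℤ × ℤ) : Set (ℤ × ℤ) :=
  {x | (∃ k : ℕ, 1 ≤ k ∧ x + (k : ℤ) • d ∈ P) ∧ (x = u ∨ u.2 < x.2)}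

/-- The geometry of a shape `P`, with first cell `a`, whose translates by multiples of `d` are
stacked below each other. -/
structure Layout (P : Set (ℤ × ℤ)) (d a : ℤ × ℤ) : Prop where
  finite : P.Finite
  mem : a ∈ P
  le : ∀ x ∈ P, a ≤ x
  lt : ∀ x ∈ P, x.1 < a.1 + d.1
  snd_pos : 0 < d.2
  path : ∀ x ∈ P, Relation.ReflTransGen (Step P) a x
  corner_mem : a - (1, 0) + d ∈ P
  past_path : ∀ n, 1 ≤ n → ∀ x ∈ past P d n, x ≤ a - (1, 0) →
    Relation.ReflTransGen (Step (past P d n)) x (a - (1, 0))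

theorem translate_past_succ (P : Set (ℤ × ℤ)) (d : ℤ × ℤ) (n : ℕ) :
    translate (past P d (n + 1)) d = past P d n ∪ P := by
  ext x
  rw [mem_translate]
  have e (k : ℕ) : x - d + ((k + 1 : ℕ) : ℤ) • d = x + (k : ℤ) • d := by
    push_cast
    rw [add_smul, one_smul]
    abel
  constructor
  · rintro ⟨k, h1, h2, h3⟩
    obtain ⟨k, rfl⟩ := Nat.exists_eq_add_of_le' h1
    rw [e] at h3
    rcases Nat.eq_zero_or_pos k with rfl | hk
    · exact Or.inr (by simpa using h3)
    · exact Or.inl ⟨k, hk, by omega, h3⟩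
  · rintro (⟨k, h1, h2, h3⟩ | h)
    · exact ⟨k + 1, by omega, by omega, by rwa [e]⟩
    · exact ⟨0 + 1, by omega, by omega, by rw [e]; simpa using h⟩

theorem finite_past {P : Set (ℤ × ℤ)} (hP : P.Finite) (d : ℤ × ℤ) (n : ℕ) :
    (past P d n).Finite := by
  refine ((Set.finite_Icc 1 n).biUnion fun k _ => hP.image fun x => x - (k : ℤ) • d).subset ?_
  rintro x ⟨k, h1, h2, h3⟩
  exact Set.mem_biUnion (x := k) ⟨h1, h2⟩ ⟨_, h3, by simp⟩

theorem past_mono (P : Set (ℤ × ℤ)) (d : ℤ × ℤ) {m n : ℕ} (h : m ≤ n) :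
    past P d m ⊆ past P d n :=
  fun _ ⟨k, h1, h2, h3⟩ => ⟨k, h1, h2.trans h, h3⟩

theorem frontier_inter_past_subset {P : Set (ℤ × ℤ)} {d u : ℤ × ℤ} {n : ℕ} {x : ℤ × ℤ}
    (hx : x ∈ past P d n) (h : x = u ∨ u.2 < x.2) : x ∈ frontier P d u :=
  ⟨hx.imp fun _ hk => ⟨hk.1, hk.2.2⟩, h⟩

theorem ncard_linExt_eq_sum {S I : Set (ℤ × ℤ)} (hS : S.Finite) (hI : I ⊆ S)
    [Fintype (LinExt I)] :
    (LinExt S).ncard = ∑ κ : LinExt I, {σ | σ ∈ LinExt S ∧ restrict I σ = κ}.ncard := by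
  have fS (κ : LinExt I) : Finite {σ | σ ∈ LinExt S ∧ restrict I σ = κ} :=
    ((finite_linExt hS).subset fun _ h => h.1).to_subtype
  simp only [← Nat.card_coe_set_eq]
  rw [← Nat.card_sigma]
  refine Nat.card_congr
    { toFun := fun σ => ⟨⟨restrict I σ.1, IsLinExt.restrict σ.2 hI⟩, σ.1, σ.2, rfl⟩
      invFun := fun s => ⟨s.2.1, s.2.2.1⟩
      left_inv := fun _ => rfl
      right_inv := ?_ }
  rintro ⟨⟨κ, hκ⟩, ⟨σ, hσ, h⟩⟩
  dsimp only at h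
  subst h
  rfl

theorem ncard_shift_eq (S T : Set (ℤ × ℤ)) (v : ℤ × ℤ) (τ : Set ((ℤ × ℤ) × (ℤ × ℤ))) :
    {ρ | ρ ∈ LinExt (translate S v) ∧ restrict (translate T v) ρ = shift v τ}.ncard =
      {σ | σ ∈ LinExt S ∧ restrict T σ = τ}.ncard := by
  refine (Nat.card_congr ((shiftEquiv v).subtypeEquiv fun σ => ?_)).symm
  refine and_congr shift_mem_linExt.symm ?_
  change _ ↔ restrict (translate T v) (shift v σ) = shift v τ
  rw [restrict_translate_shift]
  exact (shiftEquiv v).injective.eq_iff.symm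

/-! ### The transfer matrix of the stacked copies -/

namespace Layout

variable {P : Set (ℤ × ℤ)} {d a : ℤ × ℤ}

theorem fst_pos (h : Layout P d a) : 0 < d.1 := by
  have := h.lt a h.mem
  omega

theorem fst_lt_of_mem_past (h : Layout P d a)
    {n : ℕ} {x : ℤ × ℤ} (hx : x ∈ past P d n) : x.1 < a.1 := by
  obtain ⟨k, h1, -, h3⟩ := hx
  have h4 := h.lt _ h3
  simp only [Prod.fst_add, Prod.smul_fst, smul_eq_mul] at h4
  have h5 : (1 : ℤ) ≤ k := by exact_mod_cast h1
  nlinarith [h.fst_pos]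

theorem notMem_of_mem_past (h : Layout P d a) (n : ℕ)
    {x : ℤ × ℤ} (hx : x ∈ past P d n) : x ∉ P := by
  intro hx'
  have h1 := h.fst_lt_of_mem_past hx
  have h2 := (h.le x hx').1
  omega

theorem corner_mem_frontier (h : Layout P d a) : a - (1, 0) ∈ frontier P d (a - (1, 0)) :=
  ⟨⟨1, le_rfl, by simpa using h.corner_mem⟩, Or.inl rfl⟩

/-- Shifting by `d` sends `u` into `P` and moves each other cell one copy later and further right,
so it stays right of `u`. The new frontier is thus visible in the glued piece. -/
theorem translate_frontier_subset (h : Layout P d a) :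
    translate (frontier P d (a - (1, 0))) d ⊆ frontier P d (a - (1, 0)) ∪ P := by
  intro x hx
  obtain ⟨⟨k, h1, h2⟩, h3⟩ := mem_translate.1 hx
  rcases h3 with h3 | h3
  · refine Or.inr ?_
    rw [sub_eq_iff_eq_add.1 h3]
    exact h.corner_mem
  have hd := h.snd_pos
  obtain ⟨k, rfl⟩ := Nat.exists_eq_add_of_le' h1
  have e : x - d + ((k + 1 : ℕ) : ℤ) • d = x + (k : ℤ) • d := by
    push_cast
    rw [add_smul, one_smul]
    abel
  rw [e] at h2
  rcases Nat.eq_zero_or_pos k with rfl | hk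
  · exact Or.inr (by simpa using h2)
  · refine Or.inl ⟨⟨k, hk, h2⟩, Or.inr ?_⟩
    simp only [Prod.snd_sub] at h3 ⊢
    omega

/-- Each copy further back lies at least one column further left because `0 < d.2`, so only finitely
many copies reach the columns right of `u`. -/
theorem exists_frontier_subset_past (h : Layout P d a) :
    ∃ K, 1 ≤ K ∧ frontier P d (a - (1, 0)) ⊆ past P d K := by
  obtain ⟨M, hM⟩ := (h.finite.image Prod.snd).bddAbove
  refine ⟨(M - a.2).toNat + 1, by omega, ?_⟩
  rintro x ⟨⟨k, h1, h2⟩, rfl | h3⟩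
  · exact ⟨1, le_rfl, by omega, by simpa using h.corner_mem⟩
  · refine ⟨k, h1, ?_, h2⟩
    have h4 := hM ⟨_, h2, rfl⟩
    simp only [Prod.snd_add, Prod.smul_snd, smul_eq_mul, Prod.snd_sub, sub_zero] at h3 h4
    have h5 : (k : ℤ) ≤ k * d.2 := le_mul_of_one_le_right (by positivity) h.snd_pos
    omega

theorem finite_frontier (h : Layout P d a) : (frontier P d (a - (1, 0))).Finite := by
  obtain ⟨K, -, hK⟩ := h.exists_frontier_subset_past
  exact (finite_past h.finite d K).subset hK

/-- The first factor in each summand does not depend on `n`: it is the matrix entry at `(τ, κ)`. -/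
theorem transfer (h : Layout P d a)
    {F : Set (ℤ × ℤ)} (e : frontier P d (a - (1, 0)) = F) {n : ℕ} (hn : 1 ≤ n)
    (hF : F ⊆ past P d n) [Fintype (LinExt F)] (τ : Set ((ℤ × ℤ) × (ℤ × ℤ))) :
    {ρ | ρ ∈ LinExt (past P d (n + 1)) ∧ restrict (F) ρ = τ}.ncard =
      ∑ κ : LinExt F,
        {π | π ∈ LinExt (F ∪ P) ∧
          restrict (F) π = κ ∧
          restrict (translate (F) d) π = shift d τ}.ncard *
        {σ | σ ∈ LinExt (past P d n) ∧ restrict (F) σ = κ}.ncard := by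
  have hfin := h.finite_frontier
  have hsub := h.translate_frontier_subset
  rw [e] at hfin hsub
  have hu : a - (1, 0) ∈ F := e ▸ h.corner_mem_frontier
  have hU : past P d n ∪ P = past P d n ∪ (F ∪ P) := by
    rw [← Set.union_assoc, Set.union_eq_self_of_subset_right hF]
  have hI : past P d n ∩ (F ∪ P) = F := by
    ext x
    refine ⟨fun hx => hx.2.resolve_right (h.notMem_of_mem_past n hx.1), fun hx => ⟨hF hx, Or.inl hx⟩⟩
  have hnew : ∀ y ∈ (F ∪ P) \ past P d n, y ∈ P := fun y hy =>
    hy.1.resolve_left fun hy' => hy.2 (hF hy')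
  rw [← ncard_shift_eq _ _ d, translate_past_succ, hU]
  refine card_linExt_union (u := a - (1, 0)) (finite_past h.finite d n)
    (hfin.union h.finite) hI hu ?_ ?_ ?_ hsub _
  -- An old cell outside the frontier is weakly above and to the left of `u`, hence joined to `u` by
  -- a monotone path.
  · rintro σ hσ x ⟨hx, hxF⟩
    have h1 := h.fst_lt_of_mem_past hx
    have h2 : ¬ (x = a - (1, 0) ∨ (a - (1, 0)).2 < x.2) := fun h' =>
      hxF (Or.inl (e ▸ frontier_inter_past_subset hx h'))
    push Not at h2
    have h3 := h.past_path n hn x hx (Prod.mk_le_mk.2 ⟨by simp; omega, h2.2⟩)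
    exact (IsLinExt.of_path hσ le_rfl h3).resolve_left h2.1
  -- A new cell is reached from `a` inside `P`, and `a` is the lower neighbour of `u`.
  · intro π hπ y hy
    have h1 : (a - (1, 0), a) ∈ π :=
      IsLinExt.covers hπ (Or.inl hu) (Or.inr h.mem) (Or.inr (by simp))
    rcases IsLinExt.of_path hπ Set.subset_union_right (h.path y (hnew y hy)) with h2 | h2
    · rwa [← h2]
    · exact IsLinExt.trans hπ h1 h2
  · intro y hy x hx hyx
    have h1 := h.fst_lt_of_mem_past hx
    have h2 := (h.le y (hnew y hy)).1
    rcases hyx with rfl | rfl <;> simp at h1 <;> omega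

theorem exists_recurrence (h : Layout P d a)
    {F : Set (ℤ × ℤ)} (e : frontier P d (a - (1, 0)) = F) {N : ℕ} (hN : 1 ≤ N)
    (hF : F ⊆ past P d N) :
    ∃ r : ℕ, 1 ≤ r ∧ r ≤ (LinExt F).ncard ∧
      ∃ c : ℕ → ℤ, c r ≠ 0 ∧
        ∀ n : ℕ, N + (LinExt F).ncard ≤ n →
          ((LinExt (past P d n)).ncard : ℤ) =
            ∑ i ∈ Finset.Icc 1 r, c i * ((LinExt (past P d (n - i))).ncard : ℤ) := by
  classical
  have := (finite_linExt (e ▸ h.finite_frontier : F.Finite)).fintype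
  have hcard : (LinExt F).ncard = Fintype.card (LinExt F) := by
    rw [← Nat.card_coe_set_eq, Nat.card_eq_fintype_card]
  have hsum : ∀ n, N ≤ n → ((LinExt (past P d n)).ncard : ℤ) =
      ∑ κ : LinExt F, ({σ | σ ∈ LinExt (past P d n) ∧ restrict F σ = κ}.ncard : ℤ) := by
    intro n hn
    rw [ncard_linExt_eq_sum (finite_past h.finite d n) (hF.trans (past_mono P d hn))]
    push_cast
    rfl
  obtain ⟨r, h1, h2, c, h3, h4⟩ := exists_recurrence_of_transfer
    (Matrix.of fun τ κ : LinExt F => ({π | π ∈ LinExt (F ∪ P) ∧ restrict F π = κ ∧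
          restrict (translate F d) π = shift d τ}.ncard : ℤ))
    (fun n κ => ({σ | σ ∈ LinExt (past P d n) ∧ restrict F σ = κ}.ncard : ℤ)) N
    (by
      intro n hn
      funext τ
      have := h.transfer e (hN.trans hn) (hF.trans (past_mono P d hn)) τ.1
      rw [this]
      simp [Matrix.mulVec, dotProduct])
    (by
      rw [← hsum _ (by omega)]
      exact_mod_cast ((linExt_nonempty _).ncard_pos
        (finite_linExt (finite_past h.finite d _))).ne')
  rw [hcard]
  refine ⟨r, h1, h2, c, h3, fun n hn => ?_⟩
  rw [hsum n (by omega), h4 n hn]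
  refine Finset.sum_congr rfl fun i hi => ?_
  rw [hsum (n - i) (by have := (Finset.mem_Icc.1 hi).2; omega)]

end Layout

/-! ### Extremal cells, normalization and the shapes `Sh` -/

theorem topLeft_spec {S : Set (ℤ × ℤ)} (hS : S.Finite) (hne : S.Nonempty) :
    topLeft S ∈ S ∧ ∀ x ∈ S, (topLeft S).1 ≤ x.1 ∧ (x.1 = (topLeft S).1 → (topLeft S).2 ≤ x.2) := by
  have hb := (hS.image Prod.fst).bddBelow
  have hb' : BddBelow {j | (topRow S, j) ∈ S} :=
    ((hS.image Prod.snd).subset fun j hj => ⟨_, hj, rfl⟩).bddBelow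
  obtain ⟨y, hy, e⟩ : topRow S ∈ Prod.fst '' S := Int.csInf_mem (hne.image _) hb
  have hm : (topRow S, y.2) ∈ S := by rwa [← e]
  refine ⟨Int.csInf_mem (s := {j | (topRow S, j) ∈ S}) ⟨_, hm⟩ hb', fun x hx =>
    ⟨csInf_le hb ⟨x, hx, rfl⟩, fun hx' => csInf_le hb' ?_⟩⟩
  change (topRow S, x.2) ∈ S
  have hx'' : x.1 = topRow S := hx'
  rwa [← hx'']

theorem topLeft_eq {S : Set (ℤ × ℤ)} {a : ℤ × ℤ} (hS : S.Finite) (ha : a ∈ S)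
    (h : ∀ x ∈ S, a.1 ≤ x.1 ∧ (x.1 = a.1 → a.2 ≤ x.2)) : topLeft S = a := by
  obtain ⟨h1, h2⟩ := topLeft_spec hS ⟨a, ha⟩
  have e : (topLeft S).1 = a.1 := le_antisymm (h2 a ha).1 (h _ h1).1
  exact Prod.ext e (le_antisymm ((h2 a ha).2 e.symm) ((h _ h1).2 e))

theorem bottomLeft_spec {S : Set (ℤ × ℤ)} (hS : S.Finite) (hne : S.Nonempty) :
    bottomLeft S ∈ S ∧ ∀ x ∈ S, x.1 ≤ (bottomLeft S).1 := by
  have hb := (hS.image Prod.fst).bddAbove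
  have hb' : BddBelow {j | (bottomRow S, j) ∈ S} :=
    ((hS.image Prod.snd).subset fun j hj => ⟨_, hj, rfl⟩).bddBelow
  obtain ⟨y, hy, e⟩ : bottomRow S ∈ Prod.fst '' S := Int.csSup_mem (hne.image _) hb
  have hm : (bottomRow S, y.2) ∈ S := by rwa [← e]
  exact ⟨Int.csInf_mem (s := {j | (bottomRow S, j) ∈ S}) ⟨_, hm⟩ hb', fun x hx =>
    le_csSup hb ⟨x, hx, rfl⟩⟩

theorem topLeft_translate {S : Set (ℤ × ℤ)} (hS : S.Finite) (hne : S.Nonempty) (v : ℤ × ℤ) :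
    topLeft (translate S v) = topLeft S + v := by
  obtain ⟨h1, h2⟩ := topLeft_spec hS hne
  refine topLeft_eq (hS.image _) (mem_translate.2 (by simpa using h1)) fun x hx => ?_
  have := h2 _ (mem_translate.1 hx)
  simp only [Prod.fst_sub, Prod.snd_sub, Prod.fst_add, Prod.snd_add] at this ⊢
  omega

theorem csInf_image_translate {S : Set (ℤ × ℤ)} (hS : S.Finite) (hne : S.Nonempty) (v : ℤ × ℤ)
    (f : ℤ × ℤ →+ ℤ) : sInf (f '' translate S v) = sInf (f '' S) + f v := by
  have hb := (hS.image f).bddBelow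
  refine IsLeast.csInf_eq ⟨?_, ?_⟩
  · obtain ⟨y, hy, e⟩ := Int.csInf_mem (hne.image f) hb
    exact ⟨y + v, ⟨y, hy, rfl⟩, by rw [map_add, e]⟩
  · rintro _ ⟨_, ⟨y, hy, rfl⟩, rfl⟩
    rw [map_add]
    exact add_le_add_left (csInf_le hb ⟨y, hy, rfl⟩) _

theorem normalize_translate {S : Set (ℤ × ℤ)} (hS : S.Finite) (hne : S.Nonempty) (v : ℤ × ℤ) :
    normalize (translate S v) = normalize S := by
  have h1 := csInf_image_translate hS hne v (AddMonoidHom.fst ℤ ℤ)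
  have h2 := csInf_image_translate hS hne v (AddMonoidHom.snd ℤ ℤ)
  simp only [AddMonoidHom.coe_fst, AddMonoidHom.coe_snd] at h1 h2
  rw [normalize, normalize, translate_translate, h1, h2]
  congr 1
  ext <;> simp <;> abel

theorem ncard_SYT_translate {S : Set (ℤ × ℤ)} (hS : S.Finite) (v : ℤ × ℤ) :
    (SYT (translate S v)).ncard = (LinExt S).ncard := by
  rw [ncard_SYT (S := translate S v) (hS.image _), ncard_linExt_translate]

theorem mem_Sh {P : Set (ℤ × ℤ)} {w n : ℕ} {x : ℤ × ℤ} :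
    x ∈ Sh P w n ↔ ∃ i < n, x - (i : ℤ) • shiftVector P w ∈ P := by
  simp [Sh, mem_translate]

theorem Sh_eq_translate_past (P : Set (ℤ × ℤ)) (w n : ℕ) :
    Sh P w n = translate (past P (shiftVector P w) n) ((n : ℤ) • shiftVector P w) := by
  ext x
  rw [mem_Sh, mem_translate]
  have e (i k : ℕ) (h : i + k = n) : x - (n : ℤ) • shiftVector P w + (k : ℤ) • shiftVector P w =
      x - (i : ℤ) • shiftVector P w := by
    rw [← h]
    push_cast
    rw [add_smul]
    abel
  constructor
  · rintro ⟨i, hi, hx⟩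
    exact ⟨n - i, by omega, by omega, by rwa [e i _ (by omega)]⟩
  · rintro ⟨k, h1, h2, hx⟩
    exact ⟨n - k, by omega, by rwa [← e _ k (by omega)]⟩

/-! ### Compatible pairs give a layout -/

/-- A cell in a column left of `topLeft P` would, by antidiagonal convexity, force a cell of the top
row in that column. -/
theorem topLeft_le {P : Set (ℤ × ℤ)} (hP : IsPeriodicShape P) {x : ℤ × ℤ} (hx : x ∈ P) :
    topLeft P ≤ x := by
  obtain ⟨h1, h2⟩ := topLeft_spec hP.skew.finite ⟨_, hP.one_mem⟩
  refine ⟨(h2 x hx).1, ?_⟩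
  by_contra! hlt
  have h3 := h2 _ (hP.skew.antidiagonalConvex hx h1 (z := ((topLeft P).1, x.2)) le_rfl (h2 x hx).1
    le_rfl hlt.le)
  exact absurd (h3.2 rfl) hlt.not_ge

theorem layout {P : Set (ℤ × ℤ)} {w : ℕ} (hP : IsPeriodicShape P) (hPw : Compatible P w) :
    Layout P (shiftVector P w) (topLeft P) := by
  have hfin := hP.skew.finite
  obtain ⟨ha, ha'⟩ := topLeft_spec hfin ⟨_, hP.one_mem⟩
  obtain ⟨hb, hb'⟩ := bottomLeft_spec hfin ⟨_, hP.one_mem⟩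
  have hd1 : (shiftVector P w).1 = (bottomLeft P).1 - (topLeft P).1 + 1 := by simp [shiftVector]
  have hd2 : (shiftVector P w).2 = (bottomLeft P).2 - (topLeft P).2 + w := by simp [shiftVector]
  have hmin : ∀ x ∈ P, topLeft P ≤ x := fun x hx => topLeft_le hP hx
  generalize topLeft P = a at *
  set d := shiftVector P w with hd
  have hlt : ∀ x ∈ P, x.1 < a.1 + d.1 := fun x hx => by
    have := hb' x hx
    omega
  have hpos1 : 0 < d.1 := by
    have := hlt a ha
    omega
  have hpos2 : 0 < d.2 := by
    have := (hmin _ hb).2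
    obtain ⟨K, hK⟩ := hPw.bounded
    -- If `d.2 = 0`, the first cells of `K + 1` copies all share one column, against the bound `K`.
    by_contra hcon
    have h0 : d.2 = 0 := by omega
    have hinj : Function.Injective fun i : ℕ => a + (i : ℤ) • d := by
      intro i j hij
      have h1 := congrArg Prod.fst hij
      simpa [hpos1.ne'] using h1
    have hsub : ((Finset.range (K + 1)).image fun i : ℕ => a + (i : ℤ) • d : Set (ℤ × ℤ)) ⊆
        {x | x ∈ Sh P w (K + 1) ∧ x.2 = a.2} := by
      intro x hx
      obtain ⟨i, hi, rfl⟩ := Finset.mem_image.1 (Finset.mem_coe.1 hx)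
      exact ⟨mem_Sh.2 ⟨i, Finset.mem_range.1 hi, by simpa [← hd] using ha⟩, by simp [h0]⟩
    have h1 := Set.ncard_le_ncard hsub
      ((hPw.periodic (K + 1) (by omega)).skew.finite.subset fun _ h => h.1)
    rw [Set.ncard_coe_finset, Finset.card_image_of_injective _ hinj, Finset.card_range] at h1
    have h2 := hK (K + 1) (by omega) a.2
    omega
  have hcorner : a - (1, 0) + d ∈ P := by
    have h2 := hPw.periodic 2 (by omega)
    have m0 : a ∈ Sh P w 2 := mem_Sh.2 ⟨0, by omega, by simpa using ha⟩
    have m1 : a + d ∈ Sh P w 2 := mem_Sh.2 ⟨1, by omega, by simpa [← hd] using ha⟩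
    have hle : a ≤ a + d := Prod.mk_le_mk.2 ⟨by simpa using hpos1.le, by simpa using hpos2.le⟩
    rcases Relation.ReflTransGen.cases_tail
      (reflTransGen_step h2.skew.antidiagonalConvex h2.connected m0 m1 hle) with e | ⟨y, -, hy⟩
    · have := congrArg Prod.fst e
      simp at this
      omega
    obtain ⟨hy, -, hcov⟩ := hy
    obtain ⟨i, hi, hyi⟩ := mem_Sh.1 hy
    rw [← hd] at hyi
    -- The cell before `a + d` on a monotone path is its left or upper neighbour, in copy `0` or
    -- `1`. Copy `0` ends above the row of `a + d`, and `a + d` is first in copy `1`, so only the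
    -- upper neighbour in copy `0` survives.
    rcases hcov with e | e <;> rw [← sub_eq_iff_eq_add] at e <;> subst e <;> interval_cases i
    · have := hlt _ hyi
      simp at this
    · have := ha' _ hyi
      simp at this
      omega
    · convert hyi using 1
      simp
      abel
    · have := ha' _ hyi
      simp at this
      omega
  refine ⟨hfin, ha, hmin, hlt, hpos2, fun x hx =>
    reflTransGen_step hP.skew.antidiagonalConvex hP.connected ha hx (hmin x hx), hcorner, ?_⟩
  intro n hn x hx hxu
  have hS := hPw.periodic n hn
  have hu : a - (1, 0) ∈ past P d n := ⟨1, le_rfl, hn, by simpa using hcorner⟩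
  have e := Sh_eq_translate_past P w n
  rw [← hd] at e
  have hpath := reflTransGen_step hS.skew.antidiagonalConvex hS.connected
    (x := x + (n : ℤ) • d) (y := a - (1, 0) + (n : ℤ) • d)
    (e ▸ mem_translate.2 (by simpa using hx)) (e ▸ mem_translate.2 (by simpa using hu))
    (by simpa using hxu)
  have := hpath.lift (p := Step (past P d n)) (fun z => z + -((n : ℤ) • d)) fun y z hyz => by
    have := hyz.translate (-((n : ℤ) • d))
    rwa [e, translate_translate, add_neg_cancel, translate_zero] at this
  simpa only [Function.onFun, add_neg_cancel_right] using this

/-! ### The index shape, its dimension and the threshold -/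

theorem cornerCell_eq {P : Set (ℤ × ℤ)} (hfin : P.Finite) (hne : P.Nonempty) (w m : ℕ) :
    cornerCell P w m = topLeft P - (1, 0) + (m : ℤ) • shiftVector P w := by
  rw [cornerCell, lastTopLeft, topLeft_translate hfin hne, sub_smul, one_smul]
  abel

namespace Layout

variable {P : Set (ℤ × ℤ)} {w : ℕ}

/-- All old cells lie in rows above that of `a`, so the row condition in `corner` is automatic and
only the column condition matters. -/
theorem corner_Sh (h : Layout P (shiftVector P w) (topLeft P)) {m : ℕ}
    (hm : frontier P (shiftVector P w) (topLeft P - (1, 0)) ⊆ past P (shiftVector P w) m) :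
    corner (Sh P w m) (cornerCell P w m) =
      translate (frontier P (shiftVector P w) (topLeft P - (1, 0)))
        ((m : ℤ) • shiftVector P w) := by
  rw [cornerCell_eq h.finite ⟨_, h.mem⟩, Sh_eq_translate_past]
  ext x
  simp only [corner, Set.mem_ofPred_eq, mem_translate, ← sub_eq_iff_eq_add]
  constructor
  · rintro ⟨h1, h2⟩
    refine frontier_inter_past_subset h1 (h2.imp_right fun h3 => ?_)
    have := h3.2
    simp at this ⊢
    omega
  · intro hx
    refine ⟨hm hx, hx.2.imp_right fun h3 => ?_⟩
    have h4 := h.fst_lt_of_mem_past (hm hx)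
    simp at h3 h4 ⊢
    omega

theorem indexShape_eq (h : Layout P (shiftVector P w) (topLeft P)) :
    indexShape P w = normalize (frontier P (shiftVector P w) (topLeft P - (1, 0))) := by
  obtain ⟨K, -, hK⟩ := h.exists_frontier_subset_past
  ext x
  refine (Filter.eventually_congr ?_).trans Filter.eventually_const
  filter_upwards [Filter.eventually_ge_atTop K] with m hm
  rw [h.corner_Sh (hK.trans (past_mono P _ hm)),
    normalize_translate h.finite_frontier ⟨_, h.corner_mem_frontier⟩]

theorem dim_eq (h : Layout P (shiftVector P w) (topLeft P)) :
    dim P w = (LinExt (frontier P (shiftVector P w) (topLeft P - (1, 0)))).ncard := by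
  rw [dim, h.indexShape_eq, normalize, ncard_SYT_translate h.finite_frontier]

theorem count_eq (h : Layout P (shiftVector P w) (topLeft P))
    (n : ℕ) : count P w n = (LinExt (past P (shiftVector P w) n)).ncard := by
  rw [count, Sh_eq_translate_past, ncard_SYT_translate (finite_past h.finite _ n)]

/-- Copies occupy disjoint bands of `d.1` rows, and `u` is in the bottom row of its band. If a cell
`k` copies back and `u` land in copies `i` and `j` of `Sh P w n`, comparing rows gives `i + k ≤ j +
1 ≤ n`, whatever the horizontal offset. -/
theorem frontier_subset_past_of_translate_subset (h : Layout P (shiftVector P w) (topLeft P))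
    {n : ℕ} {v : ℤ × ℤ}
    (hv : translate (frontier P (shiftVector P w) (topLeft P - (1, 0))) v ⊆ Sh P w n) :
    frontier P (shiftVector P w) (topLeft P - (1, 0)) ⊆ past P (shiftVector P w) n := by
  rintro x hx
  obtain ⟨i, hi, h1⟩ := mem_Sh.1 (hv ⟨x, hx, rfl⟩)
  obtain ⟨j, hj, h2⟩ := mem_Sh.1 (hv ⟨_, h.corner_mem_frontier, rfl⟩)
  obtain ⟨⟨k, hk, h3⟩, -⟩ := hx
  refine ⟨k, hk, ?_, h3⟩
  have h4 := (h.le _ h1).1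
  have h5 := h.lt _ h2
  have h6 := h.lt _ h3
  have h7 := h.fst_pos
  simp only [Prod.fst_add, Prod.fst_sub, Prod.smul_fst, smul_eq_mul] at h4 h5 h6
  zify at hj ⊢
  by_contra! hlt
  have h8 : (i : ℤ) + n + 1 ≤ i + k := by omega
  have h9 : (j : ℤ) + 2 ≤ i + k := by omega
  nlinarith

theorem threshold_spec (h : Layout P (shiftVector P w) (topLeft P)) : 1 ≤ threshold P w ∧
    frontier P (shiftVector P w) (topLeft P - (1, 0)) ⊆
      past P (shiftVector P w) (threshold P w) := by
  obtain ⟨K, hK1, hK⟩ := h.exists_frontier_subset_past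
  obtain ⟨v₀, e⟩ : ∃ v₀, indexShape P w =
      translate (frontier P (shiftVector P w) (topLeft P - (1, 0))) v₀ := ⟨_, h.indexShape_eq⟩
  have hmem : threshold P w ∈
      {m | 1 ≤ m ∧ ∃ v : ℤ × ℤ, translate (indexShape P w) v ⊆ Sh P w m} := by
    refine Nat.sInf_mem ⟨K, hK1, (K : ℤ) • shiftVector P w - v₀, ?_⟩
    rw [e, Sh_eq_translate_past, translate_translate, add_sub_cancel]
    exact Set.image_mono hK
  obtain ⟨h1, v, hv⟩ := hmem
  rw [e, translate_translate] at hv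
  exact ⟨h1, h.frontier_subset_past_of_translate_subset hv⟩

end Layout

end PeriodicSYT

theorem theorem2 (P : Set (ℤ × ℤ)) (w : ℕ)
    (hP : PeriodicSYT.IsPeriodicShape P) (hPw : PeriodicSYT.Compatible P w) :
    ∃ r : ℕ, 1 ≤ r ∧ r ≤ PeriodicSYT.dim P w ∧
      ∃ c : ℕ → ℤ, c r ≠ 0 ∧
        ∀ n : ℕ, PeriodicSYT.threshold P w + PeriodicSYT.dim P w ≤ n →
          (PeriodicSYT.count P w n : ℤ) =
            ∑ i ∈ Finset.Icc 1 r, c i * (PeriodicSYT.count P w (n - i) : ℤ) := by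
  have h := PeriodicSYT.layout hP hPw
  simp only [h.dim_eq, h.count_eq]
  exact h.exists_recurrence rfl h.threshold_spec.1 h.threshold_spec.2
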